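/- Let $N\ge 0$ and let $(\mathcal V,\mathcal E)$ be a directed acyclic graph with node set $\mathcal V=\{1,\dots,N,d\}$, where $d$ is the destination, which does not transmit. Let $q\ge 0$, let $n_{i,j}\in\{0,\dots,q\}$ be the capacity of the link $(i,j)\in\mathcal E$, and let $\mathbf S\in\mathbb F_2^{q\times q}$ be the down-shift matrix (ones exactly on the first subdiagonal). In each channel use every node $i\in\{1,\dots,N\}$ transmits one vector $\mathbf x_i\in\mathbb F_2^q$, and every node $j\in\mathcal V$ receives $$\mathbf y_j=\sum_{i\in\{1,\dots,N\}:\,(i,j)\in\mathcal E}\mathbf S^{\,q-n_{i,j}}\,\mathbf x_i .$$ For $\mathcal S\subseteq\{1,\dots,N\}$ let $\mathbf G_{\mathcal S,\mathcal S^c}$ be the matrix over $\mathbb F_2$ of the linear map that takes the transmitted vectors of the nodes in $\mathcal S$ with a link to $\mathcal V\setminus\mathcal S$ to the contribution of these nodes to the vectors received by the nodes in $\mathcal V\setminus\mathcal S$ with a link from $\mathcal S$ (its blocks are $\mathbf S^{q-n_{i,j}}$ for $(i,j)\in\mathcal E$ and $0$ otherwise). Let $n_0\ge 0$, let $\mathbf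 V$ be uniform on $\mathbb F_2^{n_0}$, let $\mathcal U_1,\dots,\mathcal U_N\subseteq\{1,\dots,n_0\}$, and let $U_i$ be the restriction of $\mathbf V$ to the coordinates in $\mathcal U_i$. For $\mathcal S \subseteq\{1,\dots,N\}$ write $U_{\mathcal S}=(U_i)_{i\in\mathcal S}$. Let $\mathbf U[1],\mathbf U[2],\dots$ be i.i.d. copies of $\mathbf U=(U_1,\dots,U_N)$. A code for $T$ source blocks and $n$ channel uses consists of strictly causal encoders, $\mathbf x_i[t]=f_i^{[t]}\big(U_i[1],\dots,U_i[T],\mathbf y_i[1],\dots,\mathbf y_i[t-1]\big)$ for $1\le t\le n$ and $1\le i\le N$, and of a decoder that produces from $\mathbf y_d[1],\dots,\mathbf y_d[n]$ an estimate of $(\mathbf U[1],\dots,\mathbf U[T])$; its error probability is the probability that this estimate is wrong. The source is called transmissible over the network if there are integers $n_T\ge 0$ with $n_T/T\to 1$ and codes for $T$ source blocks and $n_T$ channel uses, $T = 1, 2, \dots$, whose error probability tends to $0$ as $T\to\infty$. Theorem. The source $\mathbf U$ is transmissible over the network if and only if $$H\big(U_{\mathcal S}\,\big|\,U_{\mathcal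 S^c}\big)\le\operatorname{rank}\mathbf G_{\mathcal S,\mathcal S^c}\qquad\text{for all }\mathcal S\subseteq\{1,\dots,N\},$$ where $H$ is the conditional Shannon entropy in bits and, in $U_{\mathcal S^c}$, the complement is taken in $\{1,\dots,N\}$. -/

import Mathlib

open Filter Topology

namespace FFNet

/-- Vectors of `q` bits. -/
abbrev BitVec2 (q : ℕ) : Type := Fin q → ZMod 2

/-- The nodes `{1, …, N, d}`: `some i` is the sensor node `i`, and `none` is the destination `d`. -/
abbrev Node (N : ℕ) : Type := Option (Fin N)

/-- The `q × q` down-shift matrix over `𝔽₂` (ones exactly on the first subdiagonal). -/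
def shiftMatrix (q : ℕ) : Matrix (Fin q) (Fin q) (ZMod 2) :=
  Matrix.of fun a b => if (a : ℕ) = (b : ℕ) + 1 then 1 else 0

/-- A linear finite-field deterministic network on `{1, …, N, d}`: a directed acyclic graph with
link capacities `n_{i,j} ≤ q`. -/
structure Network (N : ℕ) where
  /-- The common length of the transmitted and received vectors. -/
  q : ℕ
  /-- The directed edges. -/
  edges : Finset (Node N × Node N)
  acyclic : ∀ v : Node N, ¬ Relation.TransGen (fun i j => (i, j) ∈ edges) v v
  /-- The link capacities `n_{i,j}` (relevant on edges only). -/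
  cap : Node N → Node N → ℕ
  cap_le : ∀ i j, (i, j) ∈ edges → cap i j ≤ q

namespace Network

variable {N : ℕ} (net : Network N)

/-- The matrix `S ^ (q - n_{i,j})` of the link `(i, j)`. -/
def linkMatrix (i j : Node N) : Matrix (Fin net.q) (Fin net.q) (ZMod 2) :=
  shiftMatrix net.q ^ (net.q - net.cap i j)

/-- One channel use: the vector received at `j` is the sum over the edges `(i, j)` of
`S ^ (q - n_{i,j}) x_i`. The destination does not transmit, so the sum runs over the sensor nodes
`i` only. -/
def channel (x : Fin N → BitVec2 net.q) (j : Node N) : BitVec2 net.q :=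
  ∑ i : Fin N with (some i, j) ∈ net.edges, (net.linkMatrix (some i) j).mulVec (x i)

/-- The nodes of `Ω` with a direct link to a node outside `Ω`. -/
def innerBoundary (Ω : Finset (Node N)) : Finset (Node N) :=
  Ω.filter fun i => ∃ j ∈ Ωᶜ, (i, j) ∈ net.edges

/-- The nodes outside `Ω` with a direct link from a node of `Ω`. -/
def outerBoundary (Ω : Finset (Node N)) : Finset (Node N) :=
  Ωᶜ.filter fun j => ∃ i ∈ Ω, (i, j) ∈ net.edges

/-- The transfer matrix of the cut `(Ω, Ωᶜ)`: the matrix of the linear map from the inputs of the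
nodes in the inner boundary to the outputs at the nodes in the outer boundary. -/
def transferMatrix (Ω : Finset (Node N)) :
    Matrix ({j // j ∈ net.outerBoundary Ω} × Fin net.q)
      ({i // i ∈ net.innerBoundary Ω} × Fin net.q) (ZMod 2) :=
  Matrix.of fun r c =>
    if (c.1.1, r.1.1) ∈ net.edges then net.linkMatrix c.1.1 r.1.1 r.2 c.2 else 0

/-- The rank of the transfer matrix of the cut between a set `S ⊆ {1, …, N}` and its complement in
`{1, …, N, d}`. -/
noncomputable def cutRank (S : Finset (Fin N)) : ℕ :=
  (net.transferMatrix (S.map Function.Embedding.some)).rank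

end Network

/-- A common-bits source at the nodes `1, …, N`: `n₀` uniform i.i.d. bits per source block, of which
node `i` observes those with index in `obs i`. -/
structure Source (N : ℕ) where
  n₀ : ℕ
  obs : Fin N → Finset (Fin n₀)

namespace Source

variable {N : ℕ} (src : Source N)

/-- The alphabet of the component `U_i`. -/
abbrev Symbol (i : Fin N) : Type := {l // l ∈ src.obs i} → ZMod 2

/-- The law of the bit vector `V`. -/
noncomputable def law : PMF (BitVec2 src.n₀) := PMF.uniformOfFintype _

/-- `U_i`: the restriction of `V` to the coordinates in `obs i`. -/
def U (i : Fin N) (v : BitVec2 src.n₀) : src.Symbol i := fun l => v l.1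

/-- `U_S`: the tuple of the `U_i` with `i ∈ S`. -/
def USet (S : Finset (Fin N)) (v : BitVec2 src.n₀) : (i : {i // i ∈ S}) → src.Symbol i.1 :=
  fun i => src.U i.1 v

/-- The law of `T` independent copies `V[1], …, V[T]` of the bit vector, which is the uniform law on
`T`-tuples. -/
noncomputable def blockLaw (T : ℕ) : PMF (Fin T → BitVec2 src.n₀) := PMF.uniformOfFintype _

/-- The sequence `U_i[1], …, U_i[T]` observed by node `i`. -/
def blocks {T : ℕ} (v : Fin T → BitVec2 src.n₀) (i : Fin N) : Fin T → src.Symbol i :=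
  fun τ => src.U i (v τ)

end Source

/-- The probability of an event, as a real number. -/
noncomputable def prob {Ω : Type*} (p : PMF Ω) (E : Set Ω) : ℝ := (p.toOuterMeasure E).toReal

/-- The conditional Shannon entropy `H(X | Y)` in bits,
`- ∑ P(X = a, Y = b) log₂ P(X = a | Y = b)`. -/
noncomputable def condEntropy {Ω α β : Type*} [Fintype α] [Fintype β] (p : PMF Ω)
    (X : Ω → α) (Y : Ω → β) : ℝ :=
  -∑ a, ∑ b, prob p {ω | X ω = a ∧ Y ω = b} *
    Real.logb 2 (prob p {ω | X ω = a ∧ Y ω = b} / prob p {ω | Y ω = b})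

/-- A code that sends `T` source blocks in `n` channel uses. At time `t` (counted from `0`) node `i`
transmits a function of its own `T` source blocks and of the vectors it received at the times
`0, …, t - 1`; only the times `t < n` are used. The decoder acts on what `d` received. -/
structure Code {N : ℕ} (net : Network N) (src : Source N) (T n : ℕ) where
  enc : (i : Fin N) → (t : ℕ) → (Fin T → src.Symbol i) → (Fin t → BitVec2 net.q) → BitVec2 net.q
  dec : (Fin n → BitVec2 net.q) → (i : Fin N) → Fin T → src.Symbol i

namespace Code

variable {N : ℕ} {net : Network N} {src : Source N} {T n : ℕ}

/-- The vectors received by all the nodes at time `t`, if the nodes observe the source blocks `u`. -/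
def received (c : Code net src T n) (u : (i : Fin N) → Fin T → src.Symbol i) (t : ℕ) :
    Node N → BitVec2 net.q :=
  net.channel fun i => c.enc i t (u i) fun s : Fin t => received c u s.1 (some i)
termination_by t
decreasing_by exact s.2

/-- The destination's estimate of all the source blocks. -/
def decoded (c : Code net src T n) (u : (i : Fin N) → Fin T → src.Symbol i) :
    (i : Fin N) → Fin T → src.Symbol i :=
  c.dec fun t => c.received u t.1 none

/-- The probability that the destination does not recover all the source blocks. -/
noncomputable def errorProb (c : Code net src T n) : ℝ :=
  prob (src.blockLaw T) {v | c.decoded (src.blocks v) ≠ src.blocks v}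

end Code

/-- The source is transmissible over the network, at one source block per channel use: there are
codes for `T` source blocks and `n_T` channel uses, with `n_T / T → 1`, whose probability of error
vanishes as `T → ∞`. -/
def Transmissible {N : ℕ} (net : Network N) (src : Source N) : Prop :=
  ∃ (n : ℕ → ℕ) (c : (T : ℕ) → Code net src T (n T)),
    Tendsto (fun T : ℕ => (n T : ℝ) / (T : ℝ)) atTop (𝓝 1) ∧
      Tendsto (fun T : ℕ => (c T).errorProb) atTop (𝓝 0)

end FFNet

/-! ### Conditional entropy as a number of private bits -/

namespace FFNet

/-! For common-bits sources `H(U_S | U_{S^c})` is the number `h(S)` of bits seen in `S` only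
(`condEntropy_eq`), so the criterion becomes `h(S) ≤ rank G_S`.

Necessity is a count. The non-private bits and the `n` signals across the cut determine everything
received at `d`, so at most `2^(T (n₀ - h) + n r)` source values are decoded correctly
(`card_correct_le`). If `h > r`, the success probability cannot tend to `1`.

Sufficiency uses linear encoders that vary in time, on the network itself. By linearity, decoding is
exact once every nonzero block tuple `u` produces a nonzero vector at `d`. For fixed `u`, let `A` be
the set of nodes with a nonzero observation so far. While `d ∉ A`, uniformly random maps leave `A`
unchanged with probability at most `2^(-rank G_A) ≤ 2^(-h(A))`. Hence `missBound`, with `s` channel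
uses left, does not grow on average in a step (`sum_missBound_le`), and the encoders can be fixed
one time at a time without increasing its sum over all `u` (`exists_sum_missBound_le`). At most
`2^(T h(S))` tuples have support `S`, so with `T + m` channel uses the initial sum is at most
polynomial over `2^m` (`sum_missBound_initial_le`). Once it is below `1`, every `u` reaches `d` and
the error is exactly zero; `m = √T` suffices for large `T`. -/

theorem prob_uniformOfFintype {α : Type*} [Fintype α] [Nonempty α] (p : α → Prop)
    [DecidablePred p] :
    prob (PMF.uniformOfFintype α) {a | p a} =
      ((Finset.univ.filter p).card : ℝ) / (Fintype.card α : ℝ) := by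
  classical
  rw [prob, PMF.toOuterMeasure_uniformOfFintype_apply, ENNReal.toReal_div, ENNReal.toReal_natCast,
    ENNReal.toReal_natCast, ← Fintype.card_subtype]
  simp only [Set.coe_ofPred]

theorem card_filter_eqOn {ι α : Type*} [Fintype ι] [DecidableEq ι] [Fintype α] [DecidableEq α]
    (C : Finset ι) (w : ι → α) [DecidablePred fun v : ι → α => ∀ l ∈ C, v l = w l] :
    (Finset.univ.filter fun v : ι → α => ∀ l ∈ C, v l = w l).card =
      Fintype.card α ^ (Fintype.card ι - C.card) := by
  have h : (Finset.univ.filter fun v : ι → α => ∀ l ∈ C, v l = w l) =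
      Fintype.piFinset fun l => if l ∈ C then {w l} else Finset.univ := by
    ext v
    simp only [Finset.mem_filter, Finset.mem_univ, true_and, Fintype.mem_piFinset]
    refine forall_congr' fun l => ?_
    split_ifs with hl <;> simp [hl]
  rw [h, Fintype.card_piFinset, ← Finset.card_compl, ← Finset.prod_const,
    ← Finset.prod_compl_mul_prod C]
  rw [Finset.prod_congr rfl (g := fun _ => Fintype.card α), Finset.prod_eq_one (s := C), mul_one]
  · intro l hl; simp [hl]
  · intro l hl
    rw [if_neg (Finset.mem_compl.1 hl), Finset.card_univ]

namespace Source

variable {N : ℕ} (src : Source N)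

/-- The bits observed by nodes of `S` only. -/
def privateBits (S : Finset (Fin N)) : Finset (Fin src.n₀) :=
  S.biUnion src.obs \ Sᶜ.biUnion src.obs

theorem mem_privateBits {S : Finset (Fin N)} {l : Fin src.n₀} :
    l ∈ src.privateBits S ↔ (∃ i ∈ S, l ∈ src.obs i) ∧ ∀ i ∉ S, l ∉ src.obs i := by
  simp [privateBits]

theorem privateBits_mono {S S' : Finset (Fin N)} (h : S ⊆ S') :
    src.privateBits S ⊆ src.privateBits S' := by
  intro l
  simp only [mem_privateBits]
  rintro ⟨⟨i, hi, hl⟩, h'⟩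
  exact ⟨⟨i, h hi, hl⟩, fun j hj => h' j fun hj' => hj (h hj')⟩

theorem USet_eq_iff {S : Finset (Fin N)} {v w : BitVec2 src.n₀} :
    src.USet S v = src.USet S w ↔ ∀ l ∈ S.biUnion src.obs, v l = w l := by
  simp only [Finset.mem_biUnion, funext_iff, USet, U, Subtype.forall]
  exact ⟨fun h l ⟨i, hi, hl⟩ => h i hi l hl, fun h i hi l hl => h l ⟨i, hi, hl⟩⟩

/-- Given `U_{S^c}`, exactly the private bits of `S` remain free and uniform, so every attained pair
has conditional probability `2^(-h)`. Unattained pairs have weight zero. -/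
theorem condEntropy_eq (S : Finset (Fin N)) :
    condEntropy src.law (src.USet S) (src.USet Sᶜ) = ((src.privateBits S).card : ℝ) := by
  classical
  set X := src.USet S
  set Y := src.USet Sᶜ
  have key : ∀ a b, prob src.law {v | X v = a ∧ Y v = b} *
      Real.logb 2 (prob src.law {v | X v = a ∧ Y v = b} / prob src.law {v | Y v = b}) =
      prob src.law {v | X v = a ∧ Y v = b} * (-((src.privateBits S).card : ℝ)) := by
    intro a b
    by_cases h : ∃ w, X w = a ∧ Y w = b
    · obtain ⟨w, rfl, rfl⟩ := h
      congr 1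
      set B := Sᶜ.biUnion src.obs
      have hXY : ∀ v, (X v = X w ∧ Y v = Y w) ↔
          ∀ l ∈ src.privateBits S ∪ B, v l = w l := by
        intro v
        rw [src.USet_eq_iff, src.USet_eq_iff, privateBits, Finset.sdiff_union_self_eq_union]
        simp only [Finset.mem_union, or_imp, forall_and]
      have hY : ∀ v, (Y v = Y w) ↔ ∀ l ∈ B, v l = w l := fun v => src.USet_eq_iff
      have hd : Disjoint (src.privateBits S) B := Finset.sdiff_disjoint
      have hc := Finset.card_union_of_disjoint hd
      have hle : (src.privateBits S ∪ B).card ≤ src.n₀ := by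
        simpa using Finset.card_le_univ (src.privateBits S ∪ B)
      simp only [law, hXY]
      simp only [hY]
      rw [prob_uniformOfFintype, prob_uniformOfFintype, card_filter_eqOn, card_filter_eqOn,
        ZMod.card, Fintype.card_fin, div_div_div_cancel_right₀ (by simp)]
      rw [show src.n₀ - B.card = (src.n₀ - (src.privateBits S ∪ B).card) +
        (src.privateBits S).card by omega]
      push_cast
      rw [pow_add, div_mul_cancel_left₀ (by positivity), Real.logb_inv, Real.logb_pow]
      simp
    · have : {v | X v = a ∧ Y v = b} = ∅ := by
        ext v; simpa using fun h1 h2 => h ⟨v, h1, h2⟩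
      simp [this, prob]
  have total : ∑ a, ∑ b, prob src.law {v | X v = a ∧ Y v = b} = 1 := by
    simp only [law, prob_uniformOfFintype]
    rw [← Fintype.sum_prod_type', ← Finset.sum_div, ← Nat.cast_sum]
    have := Finset.card_eq_sum_card_fiberwise (s := (Finset.univ : Finset (BitVec2 src.n₀)))
      (t := Finset.univ) (f := fun v => (X v, Y v)) (by simp)
    simp only [Prod.ext_iff] at this
    rw [← this, Finset.card_univ, div_self (by simp)]
  unfold condEntropy
  simp only [key, ← Finset.sum_mul, total]
  ring

end Source

end FFNet

/-! ### Signals across a cut, and necessity -/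

namespace FFNet

namespace Network

variable {N : ℕ} (net : Network N)

/-- The contribution of the nodes of `Ω` to the vectors received across the cut. -/
def cutSignal (Ω : Finset (Node N)) (x : Fin N → BitVec2 net.q)
    (r : {j // j ∈ net.outerBoundary Ω} × Fin net.q) : ZMod 2 :=
  ∑ i : Fin N with some i ∈ Ω ∧ (some i, r.1.1) ∈ net.edges,
    (net.linkMatrix (some i) r.1.1).mulVec (x i) r.2

/-- Nodes of `Ω` off the inner boundary have no edge across the cut, so summing over all of `Ω`
changes nothing. The default `0` stands for the silent destination. -/
theorem transferMatrix_mulVec (Ω : Finset (Node N)) (x : Fin N → BitVec2 net.q) :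
    (net.transferMatrix Ω).mulVec (fun c => (c.1.1.elim 0 x : BitVec2 net.q) c.2) =
      net.cutSignal Ω x := by
  funext r
  have hr : r.1.1 ∉ Ω := by
    have := r.1.2
    simp only [outerBoundary, Finset.mem_filter, Finset.mem_compl] at this
    exact this.1
  have h1 : (net.transferMatrix Ω).mulVec (fun c => (c.1.1.elim 0 x : BitVec2 net.q) c.2) r =
      ∑ i : {i // i ∈ net.innerBoundary Ω}, if (i.1, r.1.1) ∈ net.edges then
        (net.linkMatrix i.1 r.1.1).mulVec (i.1.elim 0 x) r.2 else 0 := by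
    simp only [Matrix.mulVec, dotProduct, Fintype.sum_prod_type, transferMatrix, Matrix.of_apply]
    refine Finset.sum_congr rfl fun i _ => ?_
    split_ifs <;> simp
  rw [h1, Finset.sum_coe_sort (net.innerBoundary Ω) (fun i : Node N =>
    if (i, r.1.1) ∈ net.edges then
      (net.linkMatrix i r.1.1).mulVec (i.elim 0 x) r.2 else 0), ← Finset.sum_filter,
    Finset.sum_subset (s₂ := Finset.univ.filter fun i : Node N => i ∈ Ω ∧ (i, r.1.1) ∈ net.edges),
    Finset.sum_filter, Fintype.sum_option, cutSignal, Finset.sum_filter]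
  · simp
  · intro i
    simp only [innerBoundary, Finset.mem_filter, Finset.mem_univ, true_and]
    exact fun h => ⟨h.1.1, h.2⟩
  · intro i
    simp only [innerBoundary, Finset.mem_filter, Finset.mem_univ, true_and, Finset.mem_compl]
    exact fun h h' => absurd ⟨⟨h.1, _, hr, h.2⟩, h.2⟩ h'

theorem channel_apply_eq_cutSignal {Ω : Finset (Node N)} {x : Fin N → BitVec2 net.q}
    (hx : ∀ i, some i ∉ Ω → x i = 0) (r : {j // j ∈ net.outerBoundary Ω} × Fin net.q) :
    net.channel x r.1.1 r.2 = net.cutSignal Ω x r := by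
  rw [channel, cutSignal, Finset.sum_apply, Finset.sum_filter, Finset.sum_filter]
  refine Finset.sum_congr rfl fun i _ => ?_
  by_cases hi : some i ∈ Ω
  · simp [hi]
  · simp [hi, hx i hi]

theorem channel_congr_of_cutSignal {Ω : Finset (Node N)} {x x' : Fin N → BitVec2 net.q}
    (hx : ∀ i, some i ∉ Ω → x i = x' i) (hs : net.cutSignal Ω x = net.cutSignal Ω x')
    {j : Node N} (hj : j ∉ Ω) : net.channel x j = net.channel x' j := by
  have split : ∀ y : Fin N → BitVec2 net.q, net.channel y j =
      (∑ i : Fin N with some i ∈ Ω ∧ (some i, j) ∈ net.edges,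
        (net.linkMatrix (some i) j).mulVec (y i)) +
      ∑ i : Fin N with some i ∉ Ω ∧ (some i, j) ∈ net.edges,
        (net.linkMatrix (some i) j).mulVec (y i) := by
    intro y
    rw [channel, ← Finset.sum_filter_add_sum_filter_not _ (fun i => some i ∈ Ω),
      Finset.filter_filter, Finset.filter_filter]
    simp only [and_comm]
  rw [split, split]
  congr 1
  · by_cases hjo : j ∈ net.outerBoundary Ω
    · funext b
      have := congrFun hs (⟨j, hjo⟩, b)
      simpa [cutSignal, Finset.sum_apply] using this
    · have : ∀ i : Fin N, ¬ (some i ∈ Ω ∧ (some i, j) ∈ net.edges) := by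
        intro i hi
        refine hjo ?_
        simp only [outerBoundary, Finset.mem_filter, Finset.mem_compl]
        exact ⟨hj, _, hi.1, hi.2⟩
      simp [this]
  · refine Finset.sum_congr rfl fun i hi => ?_
    rw [hx i (Finset.mem_filter.1 hi).2.1]

theorem card_range_transferMatrix (Ω : Finset (Node N)) :
    Nat.card (LinearMap.range (net.transferMatrix Ω).mulVecLin) =
      2 ^ (net.transferMatrix Ω).rank := by
  rw [Module.natCard_eq_pow_finrank (K := ZMod 2), Nat.card_zmod]
  rfl

end Network

namespace Code

variable {N : ℕ} {net : Network N} {src : Source N} {T n : ℕ} (c : Code net src T n)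

/-- The vectors transmitted at time `t`. -/
def sent (u : (i : Fin N) → Fin T → src.Symbol i) (t : ℕ) (i : Fin N) : BitVec2 net.q :=
  c.enc i t (u i) fun s : Fin t => c.received u s.1 (some i)

theorem received_eq (u : (i : Fin N) → Fin T → src.Symbol i) (t : ℕ) :
    c.received u t = net.channel (c.sent u t) := by
  rw [received]; rfl

/-- By strict causality, induction on time shows that the side outside `Ω` evolves from its own
observations and the cut signals alone. -/
theorem received_congr_of_cutSignal {Ω : Finset (Node N)}
    {u u' : (i : Fin N) → Fin T → src.Symbol i} (hu : ∀ i, some i ∉ Ω → u i = u' i)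
    (hs : ∀ t < n, net.cutSignal Ω (c.sent u t) = net.cutSignal Ω (c.sent u' t))
    {t : ℕ} (ht : t < n) {j : Node N} (hj : j ∉ Ω) : c.received u t j = c.received u' t j := by
  induction t using Nat.strong_induction_on generalizing j with
  | _ t ih =>
    rw [received_eq, received_eq]
    refine net.channel_congr_of_cutSignal (fun i hi => ?_) (hs t ht) hj
    rw [sent, sent, hu i hi]
    congr 1
    funext s
    exact ih s.1 s.2 (s.2.trans ht) hi

/-- On correctly decoded inputs, the non-private bits together with the cut signals are injective:
they fix the decoder's output, which contains the private bits. Each cut signal lies in the range of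
the transfer matrix. -/
theorem card_correct_le (S : Finset (Fin N)) :
    Nat.card {v : Fin T → BitVec2 src.n₀ // c.decoded (src.blocks v) = src.blocks v} ≤
      (2 ^ (src.n₀ - (src.privateBits S).card)) ^ T * (2 ^ net.cutRank S) ^ n := by
  classical
  set Ω : Finset (Node N) := S.map Function.Embedding.some with hΩ
  have memΩ : ∀ i, some i ∈ Ω ↔ i ∈ S := fun i => by simp [hΩ]
  let φ : {v : Fin T → BitVec2 src.n₀ // c.decoded (src.blocks v) = src.blocks v} →
      (Fin T → {l // l ∉ src.privateBits S} → ZMod 2) ×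
        (Fin n → LinearMap.range (net.transferMatrix Ω).mulVecLin) := fun v =>
    (fun τ l => v.1 τ l.1, fun t => ⟨net.cutSignal Ω (c.sent (src.blocks v.1) t),
      _, net.transferMatrix_mulVec Ω _⟩)
  have hφ : Function.Injective φ := by
    rintro ⟨v, hv⟩ ⟨w, hw⟩ hvw
    have h1 : ∀ τ, ∀ l ∉ src.privateBits S, v τ l = w τ l := fun τ l hl =>
      congrFun (congrFun (congrArg Prod.fst hvw) τ) ⟨l, hl⟩
    have h2 : ∀ t < n, net.cutSignal Ω (c.sent (src.blocks v) t) =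
        net.cutSignal Ω (c.sent (src.blocks w) t) := fun t ht =>
      congrArg Subtype.val (congrFun (congrArg Prod.snd hvw) ⟨t, ht⟩)
    have hu : ∀ i, some i ∉ Ω → src.blocks v i = src.blocks w i := by
      intro i hi
      rw [memΩ] at hi
      funext τ l
      exact h1 τ l.1 fun hl => (src.mem_privateBits.1 hl).2 i hi l.2
    have hd : c.decoded (src.blocks v) = c.decoded (src.blocks w) := by
      unfold decoded
      congr 1
      funext t
      exact c.received_congr_of_cutSignal hu h2 t.2 (by simp [hΩ])
    rw [hv, hw] at hd
    ext τ l
    by_cases hl : l ∈ src.privateBits S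
    · obtain ⟨i, -, hi⟩ := (src.mem_privateBits.1 hl).1
      exact congrFun (congrFun (congrFun hd i) τ) ⟨l, hi⟩
    · exact h1 τ l hl
  have := Nat.card_le_card_of_injective φ hφ
  rw [Nat.card_prod, Nat.card_fun, Nat.card_fun, Nat.card_fun, net.card_range_transferMatrix,
    Nat.card_zmod] at this
  simpa [Fintype.card_subtype_compl, Network.cutRank] using this

theorem one_sub_errorProb_le (S : Finset (Fin N)) :
    1 - c.errorProb ≤ 2 ^ (n * net.cutRank S) / 2 ^ (T * (src.privateBits S).card) := by
  classical
  have h := c.card_correct_le S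
  have hle : (src.privateBits S).card ≤ src.n₀ := by
    simpa using Finset.card_le_univ (src.privateBits S)
  have hsum := Finset.card_filter_add_card_filter_not (s := Finset.univ)
    (fun v : Fin T → BitVec2 src.n₀ => c.decoded (src.blocks v) = src.blocks v)
  rw [Finset.card_univ] at hsum
  rw [Nat.card_eq_fintype_card, Fintype.card_subtype] at h
  rw [errorProb, Source.blockLaw, prob_uniformOfFintype]
  have hcard : Fintype.card (Fin T → BitVec2 src.n₀) =
      (2 ^ (src.n₀ - (src.privateBits S).card)) ^ T * 2 ^ (T * (src.privateBits S).card) := by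
    rw [mul_comm T, pow_mul, ← mul_pow, ← pow_add, Nat.sub_add_cancel hle]
    simp
  have hpos : (0 : ℝ) < (Fintype.card (Fin T → BitVec2 src.n₀) : ℝ) := by
    exact_mod_cast Fintype.card_pos
  rw [one_sub_div hpos.ne', div_le_div_iff₀ hpos (by positivity)]
  rw [← @Nat.cast_le ℝ] at h
  rw [← @Nat.cast_inj ℝ] at hsum hcard
  push_cast at h hsum hcard
  rw [← pow_mul 2 _ n, mul_comm _ n] at h
  simp only [ne_eq]
  rw [← hsum, add_sub_cancel_right, hsum, hcard]
  calc _ ≤ _ := mul_le_mul_of_nonneg_right h (by positivity)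
    _ = _ := by ring

end Code

theorem Transmissible.card_privateBits_le {N : ℕ} {net : Network N} {src : Source N}
    (h : Transmissible net src) (S : Finset (Fin N)) :
    (src.privateBits S).card ≤ net.cutRank S := by
  obtain ⟨n, c, hn, he⟩ := h
  by_contra! hlt
  set r := net.cutRank S
  -- This slack gives `n r ≤ T r + T / 2`; then `T ≥ 2` yields `n r + 1 ≤ T (r + 1)`, which caps the
  -- success probability at `1/2`.
  have h0 : (1 : ℝ) < 1 + 1 / (2 * (r + 1 : ℝ)) := lt_add_of_pos_right _ (by positivity)
  have e1 := hn.eventually_lt_const h0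
  have e2 := he.eventually_lt_const (show (0 : ℝ) < 1 / 2 by norm_num)
  obtain ⟨T, h1, h2, h3⟩ := (e1.and (e2.and (eventually_ge_atTop 2))).exists
  have hT : (2 : ℝ) ≤ T := by exact_mod_cast h3
  rw [div_lt_iff₀ (by linarith)] at h1
  have h4 : n T * r + 1 ≤ T * (src.privateBits S).card := by
    refine le_trans ?_ (Nat.mul_le_mul_left T hlt)
    rw [← @Nat.cast_le ℝ]
    push_cast
    have h5 : (n T : ℝ) * r ≤ (1 + 1 / (2 * (r + 1 : ℝ))) * T * r :=
      mul_le_mul_of_nonneg_right h1.le (by positivity)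
    have h6 : 1 / (2 * (r + 1 : ℝ)) * r ≤ 1 / 2 := by
      rw [div_mul_eq_mul_div, div_le_div_iff₀ (by positivity) (by norm_num)]
      linarith
    nlinarith
  have h7 := (c T).one_sub_errorProb_le S
  have h8 : (2 : ℝ) ^ (n T * r) / 2 ^ (T * (src.privateBits S).card) ≤ 1 / 2 := by
    rw [div_le_div_iff₀ (by positivity) (by norm_num), ← pow_succ, one_mul]
    exact pow_le_pow_right₀ (by norm_num) h4
  linarith

end FFNet

/-! ### One step of random linear encoding -/

namespace FFNet

namespace Network

variable {N : ℕ} (net : Network N)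

/-- One channel use as a linear map. -/
def channelLin : (Fin N → BitVec2 net.q) →ₗ[ZMod 2] (Node N → BitVec2 net.q) :=
  LinearMap.pi fun j => ∑ i : Fin N with (some i, j) ∈ net.edges,
    (net.linkMatrix (some i) j).mulVecLin ∘ₗ LinearMap.proj i

@[simp]
theorem channelLin_apply (x : Fin N → BitVec2 net.q) : net.channelLin x = net.channel x := by
  funext j
  simp [channelLin, channel]

section RandomLinear

variable {D : Fin N → Type*} [∀ i, AddCommGroup (D i)] [∀ i, Module (ZMod 2) (D i)]
  [∀ i, Finite (D i)]

/-- If the nodes of `Ω` are exactly those with a nonzero observation, then random linear encoders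
produce no signal outside `Ω` with probability at most `2 ^ (-rank)`. -/
theorem card_silent_mul_le (z : (i : Fin N) → D i) {Ω : Finset (Node N)}
    (hΩ : ∀ i, some i ∈ Ω ↔ z i ≠ 0) (hd : none ∉ Ω) :
    Nat.card {M : (i : Fin N) → D i →ₗ[ZMod 2] BitVec2 net.q //
      ∀ j ∉ Ω, net.channel (fun i => M i (z i)) j = 0} * 2 ^ (net.transferMatrix Ω).rank ≤
    Nat.card ((i : Fin N) → D i →ₗ[ZMod 2] BitVec2 net.q) := by
  let ev : ((i : Fin N) → D i →ₗ[ZMod 2] BitVec2 net.q) →ₗ[ZMod 2]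
      ({j // j ∈ net.outerBoundary Ω} × Fin net.q → ZMod 2) :=
    LinearMap.pi fun r => LinearMap.proj r.2 ∘ₗ LinearMap.proj r.1.1 ∘ₗ net.channelLin ∘ₗ
      LinearMap.pi fun i => LinearMap.applyₗ (z i) ∘ₗ LinearMap.proj i
  have ev_apply : ∀ M r, ev M r = net.channel (fun i => M i (z i)) r.1.1 r.2 := fun M r => by
    simp only [ev, LinearMap.pi_apply, LinearMap.comp_apply, LinearMap.proj_apply,
      channelLin_apply]
    rfl
  have : ∀ i, Finite (D i →ₗ[ZMod 2] BitVec2 net.q) := fun i => DFunLike.finite _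
  have : Module.Finite (ZMod 2) ((i : Fin N) → D i →ₗ[ZMod 2] BitVec2 net.q) :=
    Module.Finite.of_finite
  have hker : Nat.card {M : (i : Fin N) → D i →ₗ[ZMod 2] BitVec2 net.q //
      ∀ j ∉ Ω, net.channel (fun i => M i (z i)) j = 0} ≤ Nat.card (LinearMap.ker ev) := by
    refine Nat.card_mono (Set.toFinite _) fun M hM => ?_
    rw [SetLike.mem_coe, LinearMap.mem_ker]
    funext r
    have hr := r.1.2
    simp only [outerBoundary, Finset.mem_filter, Finset.mem_compl] at hr
    rw [ev_apply, hM _ hr.1]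
    rfl
  -- A nonzero vector can be mapped linearly to any vector, so varying the encoders realizes every
  -- input from `Ω`. Rank-nullity for `ev` then bounds its kernel, which contains the silent
  -- encoders.
  have hrange : LinearMap.range (net.transferMatrix Ω).mulVecLin ≤ LinearMap.range ev := by
    rintro _ ⟨w, rfl⟩
    let x : Fin N → BitVec2 net.q := fun i b =>
      if h : some i ∈ net.innerBoundary Ω then w (⟨some i, h⟩, b) else 0
    have hx : ∀ i, some i ∉ Ω → x i = 0 := by
      intro i hi
      have : some i ∉ net.innerBoundary Ω := fun h => hi (Finset.mem_filter.1 h).1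
      funext b
      simp [x, this]
    have hw : w = fun c => (c.1.1.elim 0 x : BitVec2 net.q) c.2 := by
      funext ⟨⟨j, hj⟩, b⟩
      cases j with
      | none => exact absurd (Finset.mem_filter.1 hj).1 hd
      | some i => simp [x, hj]
    have hM : ∀ i, ∃ M : D i →ₗ[ZMod 2] BitVec2 net.q, M (z i) = x i := by
      intro i
      by_cases hz : z i = 0
      · exact ⟨0, by rw [hx i (by rw [hΩ]; simpa using hz)]; rfl⟩
      · obtain ⟨f, hf⟩ := not_forall.1
          (mt (Module.forall_dual_apply_eq_zero_iff (ZMod 2) (z i)).1 hz)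
        exact ⟨f.smulRight ((f (z i))⁻¹ • x i), by simp [smul_smul, hf]⟩
    choose M hM using hM
    refine ⟨M, ?_⟩
    rw [Matrix.mulVecLin_apply, hw, net.transferMatrix_mulVec]
    funext r
    rw [ev_apply, funext hM, net.channel_apply_eq_cutSignal hx]
  calc _ ≤ Nat.card (LinearMap.ker ev) * Nat.card (LinearMap.range ev) := by
        rw [← net.card_range_transferMatrix]
        exact Nat.mul_le_mul hker (Nat.card_mono (Set.toFinite _) hrange)
    _ = _ := by
        rw [Module.natCard_eq_pow_finrank (K := ZMod 2),
          Module.natCard_eq_pow_finrank (K := ZMod 2) (V := LinearMap.range ev),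
          Module.natCard_eq_pow_finrank (K := ZMod 2)
            (V := (i : Fin N) → D i →ₗ[ZMod 2] BitVec2 net.q), ← pow_add, add_comm,
          LinearMap.finrank_range_add_finrank_ker]

end RandomLinear

end Network

namespace Source

variable {N : ℕ} (src : Source N)

/-- The number of private bits of the sensor nodes in a set of nodes. -/
def privateCount (A : Finset (Node N)) : ℕ :=
  (src.privateBits (Finset.univ.filter fun i => some i ∈ A)).card

theorem privateCount_mono {A B : Finset (Node N)} (h : A ⊆ B) :
    src.privateCount A ≤ src.privateCount B :=
  Finset.card_le_card (src.privateBits_mono fun i => by simpa using fun hi => h hi)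

/-- Bound on the probability that the destination stays unreached for `s` further channel uses of
random linear encoding, if `A` is the set of nodes reached so far. -/
noncomputable def missBound (s : ℕ) (A : Finset (Node N)) : ℝ :=
  if none ∈ A then 0 else
    ((2 : ℝ) ^ src.n₀ * (s + 1)) ^ Aᶜ.card / 2 ^ (s * src.privateCount A)

theorem missBound_nonneg (s : ℕ) (A : Finset (Node N)) : 0 ≤ src.missBound s A := by
  unfold missBound
  split_ifs <;> positivity

/-- Each newly reached node saves a factor of the base, and private counts only grow with the set.
-/
theorem missBound_le_of_ssubset {s : ℕ} {A B : Finset (Node N)} (h : A ⊂ B) :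
    src.missBound s B ≤
      ((2 : ℝ) ^ src.n₀ * (s + 1)) ^ (Aᶜ.card - 1) / 2 ^ (s * src.privateCount A) := by
  unfold missBound
  split_ifs
  · positivity
  · have hP : (1 : ℝ) ≤ 2 ^ src.n₀ * (s + 1) :=
      one_le_mul_of_one_le_of_one_le (one_le_pow₀ (by norm_num))
        (le_add_of_nonneg_left (Nat.cast_nonneg s))
    have hc : Bᶜ.card ≤ Aᶜ.card - 1 := by
      have := Finset.card_lt_card (Finset.compl_ssubset_compl.2 h)
      omega
    have := Nat.mul_le_mul_left s (src.privateCount_mono h.subset)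
    gcongr
    norm_num

variable (net : Network N)

/-- Supermartingale step: either `A` stays, for a fraction at most `2^(-h)` of the encoders, or it
grows and one power of the base is lost. The latter loses the factor `2^(-h)` but is absorbed by the
growth of the base from `s` to `s + 1`. -/
theorem sum_missBound_le (hcut : ∀ S, (src.privateBits S).card ≤ net.cutRank S)
    {D : Fin N → Type*} [∀ i, AddCommGroup (D i)] [∀ i, Module (ZMod 2) (D i)]
    [∀ i, Finite (D i)] [Fintype ((i : Fin N) → D i →ₗ[ZMod 2] BitVec2 net.q)]
    (z : (i : Fin N) → D i) {A : Finset (Node N)}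
    (hA : ∀ i, some i ∈ A ↔ z i ≠ 0)
    (next : ((i : Fin N) → D i →ₗ[ZMod 2] BitVec2 net.q) → Finset (Node N))
    (hnext : ∀ M j, j ∈ next M ↔ j ∈ A ∨ net.channel (fun i => M i (z i)) j ≠ 0) (s : ℕ) :
    ∑ M, src.missBound s (next M) ≤
      (Fintype.card ((i : Fin N) → D i →ₗ[ZMod 2] BitVec2 net.q) : ℝ) *
        src.missBound (s + 1) A := by
  classical
  by_cases hd : none ∈ A
  · rw [Finset.sum_eq_zero]
    · exact mul_nonneg (Nat.cast_nonneg _) (src.missBound_nonneg _ _)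
    · intro M _
      rw [missBound, if_pos ((hnext M none).2 (Or.inl hd))]
  have hsub : ∀ M, A ⊆ next M := fun M j hj => (hnext M j).2 (Or.inl hj)
  set h := src.privateCount A with hh
  set k := Aᶜ.card with hk
  have hkpos : 0 < k := Finset.card_pos.2 ⟨none, by simpa using hd⟩
  set P : ℝ := (2 : ℝ) ^ src.n₀ * (s + 1) with hP
  have hP1 : (0 : ℝ) ≤ P := by positivity
  set c := Fintype.card ((i : Fin N) → D i →ₗ[ZMod 2] BitVec2 net.q) with hc
  set silent := Finset.univ.filter fun M : (i : Fin N) → D i →ₗ[ZMod 2] BitVec2 net.q =>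
    ∀ j ∉ A, net.channel (fun i => M i (z i)) j = 0 with hsilent
  -- Since `d ∉ A`, the set `A` comes from sensor nodes and the cut condition applies to it.
  have hAmap : (Finset.univ.filter fun i => some i ∈ A).map Function.Embedding.some = A := by
    ext j
    cases j <;> simp [hd]
  have hrank : h ≤ (net.transferMatrix A).rank := by
    have := hcut (Finset.univ.filter fun i => some i ∈ A)
    rwa [Network.cutRank, hAmap] at this
  have hcard : (silent.card : ℝ) ≤ c / 2 ^ h := by
    have h1 := net.card_silent_mul_le z hA hd
    rw [Nat.card_eq_fintype_card, Nat.card_eq_fintype_card, Fintype.card_subtype] at h1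
    rw [le_div_iff₀ (by positivity)]
    have h2 : silent.card * 2 ^ h ≤ c :=
      (Nat.mul_le_mul_left _ (Nat.pow_le_pow_right (by norm_num) hrank)).trans h1
    exact_mod_cast h2
  have h2K : (2 : ℝ) ^ h ≤ 2 ^ src.n₀ := by
    refine pow_le_pow_right₀ (by norm_num) ?_
    rw [hh, privateCount]
    simpa using Finset.card_le_univ (src.privateBits (Finset.univ.filter fun i => some i ∈ A))
  have hstep : ∀ M, src.missBound s (next M) ≤
      (if M ∈ silent then P ^ k / 2 ^ (s * h) else 0) + P ^ (k - 1) / 2 ^ (s * h) := by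
    intro M
    by_cases hM : next M = A
    · have : M ∈ silent := by
        simp only [hsilent, Finset.mem_filter, Finset.mem_univ, true_and]
        intro j hj
        by_contra hne
        exact hj (hM ▸ (hnext M j).2 (Or.inr hne))
      rw [if_pos this, hM, missBound, if_neg hd]
      exact le_add_of_nonneg_right (by positivity)
    · refine (src.missBound_le_of_ssubset ((hsub M).ssubset_of_ne (Ne.symm hM))).trans ?_
      refine le_add_of_nonneg_left ?_
      split_ifs <;> positivity
  calc ∑ M, src.missBound s (next M)
      ≤ ∑ M, ((if M ∈ silent then P ^ k / 2 ^ (s * h) else 0) + P ^ (k - 1) / 2 ^ (s * h)) :=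
        Finset.sum_le_sum fun M _ => hstep M
    _ = silent.card * (P ^ k / 2 ^ (s * h)) + c * (P ^ (k - 1) / 2 ^ (s * h)) := by
        rw [Finset.sum_add_distrib, ← Finset.sum_filter, Finset.sum_const, Finset.sum_const,
          Finset.card_univ, ← hc, nsmul_eq_mul, nsmul_eq_mul, Finset.filter_mem_eq_inter,
          Finset.univ_inter]
    _ ≤ c / 2 ^ h * (P ^ k / 2 ^ (s * h)) + c * (P ^ (k - 1) / 2 ^ (s * h)) := by gcongr
    _ = c * ((P ^ k + 2 ^ h * P ^ (k - 1)) / 2 ^ ((s + 1) * h)) := by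
        rw [add_mul s 1 h, one_mul, pow_add]
        field_simp
    _ ≤ c * src.missBound (s + 1) A := by
        rw [missBound, if_neg hd]
        refine mul_le_mul_of_nonneg_left ?_ (Nat.cast_nonneg _)
        refine div_le_div_of_nonneg_right ?_ (by positivity)
        -- The reason for the base `2^n₀ (s + 1)`: one more step adds `2^n₀ ≥ 2^h`.
        have hPK : (2 : ℝ) ^ src.n₀ * ((s + 1 : ℕ) + 1) = P + 2 ^ src.n₀ := by
          rw [hP]; push_cast; ring
        rw [hPK, ← hk]
        obtain ⟨m, hm⟩ : ∃ m, k = m + 1 := ⟨k - 1, by omega⟩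
        rw [hm, Nat.add_sub_cancel, pow_succ, pow_succ]
        calc P ^ m * P + 2 ^ h * P ^ m = P ^ m * (P + 2 ^ h) := by ring
          _ ≤ (P + 2 ^ src.n₀) ^ m * (P + 2 ^ src.n₀) := by
            gcongr
            linarith [pow_nonneg (zero_le_two (α := ℝ)) src.n₀]

end Source

end FFNet

/-! ### Linear encoders over time and derandomization -/

namespace FFNet

variable {N : ℕ}

/-- Time-dependent linear encoders for `T` source blocks. -/
abbrev LinearEncoders (net : Network N) (src : Source N) (T : ℕ) : Type :=
  (t : ℕ) → (i : Fin N) →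
    ((Fin T → src.Symbol i) × (Fin t → BitVec2 net.q)) →ₗ[ZMod 2] BitVec2 net.q

namespace LinearEncoders

variable {net : Network N} {src : Source N} {T : ℕ}

/-- The vectors received at time `t` as a linear function of the source blocks. -/
def received (L : LinearEncoders net src T) (t : ℕ) :
    ((i : Fin N) → Fin T → src.Symbol i) →ₗ[ZMod 2] (Node N → BitVec2 net.q) :=
  net.channelLin ∘ₗ LinearMap.pi fun i => L t i ∘ₗ (LinearMap.proj i).prod
    (LinearMap.pi fun s : Fin t => LinearMap.proj (some i) ∘ₗ received L s.1)
termination_by t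
decreasing_by exact s.2

theorem received_apply (L : LinearEncoders net src T) (t : ℕ)
    (u : (i : Fin N) → Fin T → src.Symbol i) :
    L.received t u = net.channel fun i =>
      L t i (u i, fun s : Fin t => L.received s.1 u (some i)) := by
  rw [received, LinearMap.comp_apply, Network.channelLin_apply]
  rfl

theorem received_congr {L L' : LinearEncoders net src T} {t : ℕ} (h : ∀ s ≤ t, L s = L' s) :
    L.received t = L'.received t := by
  induction t using Nat.strong_induction_on with
  | _ t ih =>
    refine LinearMap.ext fun u => ?_
    rw [received_apply, received_apply, h t le_rfl]
    congr 1
    funext i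
    congr 2
    funext s
    rw [ih s.1 s.2 fun r hr => h r (hr.trans s.2.le)]

/-- The nodes with a nonzero observation before time `t`. -/
noncomputable def reached (L : LinearEncoders net src T) (t : ℕ)
    (u : (i : Fin N) → Fin T → src.Symbol i) : Finset (Node N) :=
  open Classical in Finset.univ.filter fun j =>
    (∃ i, j = some i ∧ u i ≠ 0) ∨ ∃ s < t, L.received s u j ≠ 0

theorem mem_reached {L : LinearEncoders net src T} {t : ℕ}
    {u : (i : Fin N) → Fin T → src.Symbol i} {j : Node N} :
    j ∈ L.reached t u ↔ (∃ i, j = some i ∧ u i ≠ 0) ∨ ∃ s < t, L.received s u j ≠ 0 := by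
  simp [reached]

theorem some_mem_reached {L : LinearEncoders net src T} {t : ℕ}
    {u : (i : Fin N) → Fin T → src.Symbol i} {i : Fin N} :
    some i ∈ L.reached t u ↔ (u i, fun s : Fin t => L.received s.1 u (some i)) ≠ 0 := by
  rw [mem_reached, Ne, Prod.mk_eq_zero, not_and_or,
    funext_iff (f := fun s : Fin t => L.received s.1 u (some i)), not_forall]
  simp [Fin.exists_iff]

/-- Method of conditional expectations: at each time some choice of maps does no worse than the
average, for all of `W` at once. Changing the maps at time `t` leaves earlier receptions intact. -/
theorem exists_sum_missBound_le (hcut : ∀ S, (src.privateBits S).card ≤ net.cutRank S)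
    (W : Finset ((i : Fin N) → Fin T → src.Symbol i)) (n : ℕ) {t : ℕ} (ht : t ≤ n) :
    ∃ L : LinearEncoders net src T, ∑ u ∈ W, src.missBound (n - t) (L.reached t u) ≤
      ∑ u ∈ W, src.missBound n ((0 : LinearEncoders net src T).reached 0 u) := by
  classical
  induction t with
  | zero => exact ⟨0, le_rfl⟩
  | succ t ih =>
    obtain ⟨L, hL⟩ := ih (by omega)
    have : ∀ i, Finite (((Fin T → src.Symbol i) × (Fin t → BitVec2 net.q)) →ₗ[ZMod 2]
      BitVec2 net.q) := fun i => DFunLike.finite _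
    let 𝓜 := (i : Fin N) → ((Fin T → src.Symbol i) × (Fin t → BitVec2 net.q)) →ₗ[ZMod 2]
      BitVec2 net.q
    let fint : Fintype 𝓜 := Fintype.ofFinite _
    have hrec : ∀ M : 𝓜, ∀ s < t, received (Function.update L t M) s = L.received s := by
      intro M s hs
      refine received_congr fun r hr => ?_
      rw [Function.update_of_ne (by omega)]
    have hnext : ∀ (u : (i : Fin N) → Fin T → src.Symbol i) (M : 𝓜) (j : Node N),
        j ∈ reached (Function.update L t M) (t + 1) u ↔ j ∈ L.reached t u ∨
          net.channel (fun i => M i (u i, fun s : Fin t => L.received s.1 u (some i))) j ≠ 0 := by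
      intro u M j
      have h1 : received (Function.update L t M) t u =
          net.channel (fun i => M i (u i, fun s : Fin t => L.received s.1 u (some i))) := by
        rw [received_apply, Function.update_self]
        congr 1
        funext i
        congr 2
        funext s
        rw [hrec M s.1 s.2]
      have h2 : (∃ s < t, received (Function.update L t M) s u j ≠ 0) ↔
          ∃ s < t, L.received s u j ≠ 0 :=
        exists_congr fun s => and_congr_right fun hs => by rw [hrec M s hs]
      rw [mem_reached, mem_reached, ← h1, or_assoc, ← h2]
      refine or_congr_right ?_
      simp only [Nat.lt_succ_iff_lt_or_eq, or_and_right, exists_or, exists_eq_left]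
    have hsum : ∑ M : 𝓜, ∑ u ∈ W, src.missBound (n - (t + 1))
          (reached (Function.update L t M) (t + 1) u) ≤
        ∑ _M : 𝓜, ∑ u ∈ W, src.missBound (n - t) (L.reached t u) := by
      rw [Finset.sum_comm, Finset.sum_const, Finset.card_univ, nsmul_eq_mul, Finset.mul_sum]
      refine Finset.sum_le_sum fun u _ => ?_
      have := src.sum_missBound_le net hcut
        (fun i => (u i, fun s : Fin t => L.received s.1 u (some i)))
        (fun i => some_mem_reached) _ (hnext u) (n - (t + 1))
      rwa [show n - (t + 1) + 1 = n - t by omega] at this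
    obtain ⟨M, -, hM⟩ := Finset.exists_le_of_sum_le ⟨(0 : 𝓜), Finset.mem_univ _⟩ hsum
    exact ⟨Function.update L t M, hM.trans hL⟩

end LinearEncoders

/-! ### Counting nonzero block tuples by support -/

namespace Source

variable (src : Source N)

theorem blocks_sub {T : ℕ} (v w : Fin T → BitVec2 src.n₀) :
    src.blocks (v - w) = src.blocks v - src.blocks w := rfl

theorem blocks_zero {T : ℕ} : src.blocks (0 : Fin T → BitVec2 src.n₀) = 0 := rfl

/-- The nonzero values of the tuple of all source blocks. -/
noncomputable def nonzeroBlocks (T : ℕ) : Finset ((i : Fin N) → Fin T → src.Symbol i) :=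
  open Classical in Finset.univ.filter fun u =>
    u ≠ 0 ∧ ∃ v : Fin T → BitVec2 src.n₀, src.blocks v = u

/-- The nodes whose source blocks do not all vanish. -/
noncomputable def support {T : ℕ} (u : (i : Fin N) → Fin T → src.Symbol i) : Finset (Fin N) :=
  open Classical in Finset.univ.filter fun i => u i ≠ 0

open Classical in
-- A tuple vanishing outside `S` vanishes on every bit seen outside `S`, so the private bits
-- determine it. The case `h = 0` is separate because such supports would gain no factor `2^(-m)`.
theorem card_support_fiber_le (T : ℕ) (S : Finset (Fin N)) :
    ((src.nonzeroBlocks T).filter fun u => src.support u = S).card ≤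
        2 ^ (T * (src.privateBits S).card) ∧
      ((src.privateBits S).card = 0 →
        (src.nonzeroBlocks T).filter (fun u => src.support u = S) = ∅) := by
  let ext : (Fin T → {l // l ∈ src.privateBits S} → ZMod 2) → Fin T → BitVec2 src.n₀ :=
    fun w τ l => if h : l ∈ src.privateBits S then w τ ⟨l, h⟩ else 0
  have key : ∀ u ∈ (src.nonzeroBlocks T).filter (fun u => src.support u = S),
      ∃ w, src.blocks (ext w) = u := by
    intro u hu
    simp only [nonzeroBlocks, Finset.mem_filter, Finset.mem_univ, true_and] at hu
    obtain ⟨⟨-, v, rfl⟩, hS⟩ := hu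
    have hz : ∀ i ∉ S, src.blocks v i = 0 := by
      intro i hi
      by_contra h
      exact hi (hS ▸ Finset.mem_filter.2 ⟨Finset.mem_univ _, h⟩)
    refine ⟨fun τ l => v τ l.1, ?_⟩
    funext i τ l
    change ext (fun τ l => v τ l.1) τ l.1 = v τ l.1
    by_cases hl : l.1 ∈ src.privateBits S
    · simp [ext, hl]
    · simp only [ext, hl, dite_false]
      by_cases hi : i ∈ S
      · have : ∃ j ∉ S, l.1 ∈ src.obs j := by
          by_contra! h
          exact hl (src.mem_privateBits.2 ⟨⟨i, hi, l.2⟩, h⟩)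
        obtain ⟨j, hj, hlj⟩ := this
        exact (congrFun (congrFun (hz j hj) τ) ⟨l.1, hlj⟩).symm
      · exact (congrFun (congrFun (hz i hi) τ) l).symm
  constructor
  · have hsub : (src.nonzeroBlocks T).filter (fun u => src.support u = S) ⊆
        Finset.univ.image fun w => src.blocks (ext w) := fun u hu => by
      simpa using key u hu
    refine ((Finset.card_le_card hsub).trans Finset.card_image_le).trans_eq ?_
    simp [← pow_mul, mul_comm]
  · intro h0
    refine Finset.eq_empty_of_forall_notMem fun u hu => ?_
    obtain ⟨w, hw⟩ := key u hu
    have h1 : ext w = 0 := by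
      funext τ l
      have : l ∉ src.privateBits S := by
        rw [Finset.card_eq_zero.1 h0]; exact Finset.notMem_empty l
      simp [ext, this]
    rw [h1, src.blocks_zero] at hw
    simp only [nonzeroBlocks, Finset.mem_filter, Finset.mem_univ, true_and] at hu
    exact hu.1.1 hw.symm

/-- Union bound: `2^(T h)` tuples against `2^(-(T + m) h)` leave at most `2^(-m)` per support. There
are `2^N` supports and at most `N + 1` unreached nodes. -/
theorem sum_missBound_initial_le (net : Network N) (T m : ℕ) :
    ∑ u ∈ src.nonzeroBlocks T,
        src.missBound (T + m) ((0 : LinearEncoders net src T).reached 0 u) ≤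
      2 ^ N * ((2 : ℝ) ^ src.n₀ * (T + m + 1)) ^ (N + 1) / 2 ^ m := by
  classical
  set P : ℝ := (2 : ℝ) ^ src.n₀ * (T + m + 1) with hP
  have hP1 : (1 : ℝ) ≤ P :=
    one_le_mul_of_one_le_of_one_le (one_le_pow₀ (by norm_num))
      (le_add_of_nonneg_left (by positivity))
  have hterm : ∀ u : (i : Fin N) → Fin T → src.Symbol i,
      src.missBound (T + m) ((0 : LinearEncoders net src T).reached 0 u) ≤
        P ^ (N + 1) / 2 ^ ((T + m) * (src.privateBits (src.support u)).card) := by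
    intro u
    have hA : (Finset.univ.filter fun i =>
        some i ∈ (0 : LinearEncoders net src T).reached 0 u) = src.support u := by
      ext i
      simp [LinearEncoders.mem_reached, support]
    unfold missBound
    split_ifs
    · positivity
    · rw [privateCount, hA, Nat.cast_add, ← hP]
      refine div_le_div_of_nonneg_right (pow_le_pow_right₀ hP1 ?_) (by positivity)
      simpa using Finset.card_le_univ ((0 : LinearEncoders net src T).reached 0 u)ᶜ
  calc _ ≤ ∑ u ∈ src.nonzeroBlocks T,
        P ^ (N + 1) / 2 ^ ((T + m) * (src.privateBits (src.support u)).card) :=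
        Finset.sum_le_sum fun u _ => hterm u
    _ = ∑ S : Finset (Fin N), ∑ u ∈ src.nonzeroBlocks T with src.support u = S,
        P ^ (N + 1) / 2 ^ ((T + m) * (src.privateBits S).card) := by
        rw [← Finset.sum_fiberwise (src.nonzeroBlocks T) src.support]
        refine Finset.sum_congr rfl fun S _ => Finset.sum_congr rfl fun u hu => ?_
        rw [(Finset.mem_filter.1 hu).2]
    _ ≤ ∑ _S : Finset (Fin N), P ^ (N + 1) / 2 ^ m := by
        refine Finset.sum_le_sum fun S _ => ?_
        obtain ⟨h1, h2⟩ := src.card_support_fiber_le T S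
        rcases Nat.eq_zero_or_pos (src.privateBits S).card with h0 | hpos
        · rw [h2 h0, Finset.sum_empty]
          positivity
        · rw [Finset.sum_const, nsmul_eq_mul, ← mul_div_assoc,
            div_le_div_iff₀ (by positivity) (by positivity)]
          have h3 : ((src.nonzeroBlocks T).filter fun u => src.support u = S).card * 2 ^ m ≤
              2 ^ ((T + m) * (src.privateBits S).card) := by
            rw [add_mul, pow_add]
            exact Nat.mul_le_mul h1 (Nat.pow_le_pow_right (by norm_num)
              (Nat.le_mul_of_pos_right m hpos))
          rw [← @Nat.cast_le ℝ] at h3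
          push_cast at h3
          calc _ = P ^ (N + 1) * (((src.nonzeroBlocks T).filter
                fun u => src.support u = S).card * 2 ^ m) := by ring
            _ ≤ _ := mul_le_mul_of_nonneg_left h3 (by positivity)
    _ = _ := by
        rw [Finset.sum_const, nsmul_eq_mul, Finset.card_univ, Fintype.card_finset,
          Fintype.card_fin, mul_div_assoc]
        norm_num

end Source

/-! ### Zero-error codes from linear encoders -/

namespace Code

variable {net : Network N} {src : Source N} {T : ℕ}

open Classical in
/-- Linear encoders together with a decoder that outputs some source blocks consistent with the
received vectors. -/
noncomputable def ofLinear (L : LinearEncoders net src T) (n : ℕ) : Code net src T n where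
  enc i t u y := L t i (u, y)
  dec y :=
    if h : ∃ v : Fin T → BitVec2 src.n₀, ∀ t : Fin n, L.received t.1 (src.blocks v) none = y t then
      src.blocks h.choose
    else 0

theorem received_ofLinear (L : LinearEncoders net src T) (n : ℕ)
    (u : (i : Fin N) → Fin T → src.Symbol i) (t : ℕ) :
    (ofLinear L n).received u t = L.received t u := by
  induction t using Nat.strong_induction_on with
  | _ t ih =>
    rw [received_eq, L.received_apply]
    congr 1
    funext i
    simp only [sent, ofLinear]
    congr 2
    funext s
    exact congrFun (ih s.1 s.2) (some i)

/-- Two distinct candidates consistent with the same reception would differ by a nonzero tuple that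
`d` never hears. -/
theorem errorProb_ofLinear_eq_zero (L : LinearEncoders net src T) (n : ℕ)
    (h : ∀ u ∈ src.nonzeroBlocks T, none ∈ L.reached n u) : (ofLinear L n).errorProb = 0 := by
  classical
  rw [errorProb, Source.blockLaw, prob_uniformOfFintype, Finset.filter_false_of_mem]
  · simp
  intro v _
  rw [not_not]
  have hex : ∃ w : Fin T → BitVec2 src.n₀, ∀ t : Fin n,
      L.received t.1 (src.blocks w) none = (ofLinear L n).received (src.blocks v) t.1 none :=
    ⟨v, fun t => by rw [received_ofLinear]⟩
  have hdec : (ofLinear L n).decoded (src.blocks v) = src.blocks hex.choose := by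
    unfold decoded
    conv_lhs => unfold ofLinear
    exact dif_pos hex
  rw [hdec]
  by_contra hne
  have hw := hex.choose_spec
  set w := hex.choose
  have hmem : src.blocks (w - v) ∈ src.nonzeroBlocks T := by
    simp only [Source.nonzeroBlocks, Finset.mem_filter, Finset.mem_univ, true_and]
    exact ⟨by rwa [src.blocks_sub, Ne, sub_eq_zero], _, rfl⟩
  rcases LinearEncoders.mem_reached.1 (h _ hmem) with ⟨i, hi, -⟩ | ⟨s, hs, hne'⟩
  · exact absurd hi (by simp)
  · refine hne' ?_
    rw [src.blocks_sub, map_sub, Pi.sub_apply, hw ⟨s, hs⟩, received_ofLinear, sub_self]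

theorem exists_errorProb_eq_zero (hcut : ∀ S, (src.privateBits S).card ≤ net.cutRank S) {m : ℕ}
    (hm : 2 ^ N * ((2 : ℝ) ^ src.n₀ * (T + m + 1)) ^ (N + 1) / 2 ^ m < 1) :
    ∃ c : Code net src T (T + m), c.errorProb = 0 := by
  obtain ⟨L, hL⟩ :=
    LinearEncoders.exists_sum_missBound_le hcut (src.nonzeroBlocks T) (T + m) le_rfl
  refine ⟨ofLinear L (T + m), errorProb_ofLinear_eq_zero _ _ fun u hu => ?_⟩
  by_contra hd
  have h1 := (hL.trans (src.sum_missBound_initial_le net T m)).trans_lt hm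
  have h2 := (Finset.single_le_sum (fun u _ => src.missBound_nonneg _ _) hu).trans_lt h1
  -- With no channel use left, an unreached destination contributes at least `1`.
  rw [Nat.sub_self, Source.missBound, if_neg hd, zero_mul, pow_zero, div_one] at h2
  refine h2.not_ge (one_le_pow₀ ?_)
  rw [Nat.cast_zero, zero_add, mul_one]
  exact one_le_pow₀ (by norm_num)

end Code

/-! ### Asymptotics with `√T` extra channel uses -/

theorem tendsto_polynomial_sqrt_div_two_pow (N n₀ : ℕ) :
    Tendsto (fun T : ℕ => 2 ^ N * ((2 : ℝ) ^ n₀ * (T + Nat.sqrt T + 1)) ^ (N + 1) /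
      2 ^ Nat.sqrt T) atTop (𝓝 0) := by
  have hsqrt : Tendsto Nat.sqrt atTop atTop :=
    tendsto_atTop.2 fun b => (eventually_ge_atTop (b * b)).mono fun a ha => Nat.le_sqrt.2 ha
  have h1 := (tendsto_pow_const_div_const_pow_of_one_lt (2 * (N + 1)) (r := (2 : ℝ))
    (by norm_num)).comp ((tendsto_add_atTop_nat 2).comp hsqrt)
  have h2 := h1.const_mul (2 ^ N * ((2 : ℝ) ^ n₀) ^ (N + 1) * 4)
  rw [mul_zero] at h2
  refine squeeze_zero (fun T => by positivity) (fun T => ?_) h2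
  -- This reduces the limit to a polynomial in `√T + 2` over `2^(√T + 2)`; the constant `4` in `h2`
  -- pays for the shift by two.
  have h3 : (T : ℝ) + Nat.sqrt T + 1 ≤ ((Nat.sqrt T + 2 : ℕ) : ℝ) ^ 2 := by
    have := Nat.sqrt_le_add T
    have h4 : T + Nat.sqrt T + 1 ≤ (Nat.sqrt T + 2) ^ 2 := by nlinarith
    exact_mod_cast h4
  simp only [Function.comp_apply]
  rw [mul_pow, pow_mul, pow_add 2 _ 2]
  calc 2 ^ N * (((2 : ℝ) ^ n₀) ^ (N + 1) * (T + Nat.sqrt T + 1) ^ (N + 1)) / 2 ^ Nat.sqrt T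
      ≤ 2 ^ N * (((2 : ℝ) ^ n₀) ^ (N + 1) * (((Nat.sqrt T + 2 : ℕ) : ℝ) ^ 2) ^ (N + 1)) /
        2 ^ Nat.sqrt T := by gcongr
    _ = _ := by
        field_simp
        norm_num

theorem tendsto_add_sqrt_div :
    Tendsto (fun T : ℕ => ((T + Nat.sqrt T : ℕ) : ℝ) / (T : ℝ)) atTop (𝓝 1) := by
  have h1 : Tendsto (fun T : ℕ => 1 + 1 / Real.sqrt T) atTop (𝓝 1) := by
    have := (Real.tendsto_sqrt_atTop.comp tendsto_natCast_atTop_atTop).const_div_atTop (1 : ℝ)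
    simpa using this.const_add (1 : ℝ)
  refine tendsto_of_tendsto_of_tendsto_of_le_of_le' tendsto_const_nhds h1 ?_ ?_
  · filter_upwards [eventually_gt_atTop 0] with T hT
    rw [le_div_iff₀ (by exact_mod_cast hT), one_mul]
    exact_mod_cast Nat.le_add_right T _
  · filter_upwards [eventually_gt_atTop 0] with T hT
    have hT' : (0 : ℝ) < T := by exact_mod_cast hT
    have h2 := Real.nat_sqrt_le_real_sqrt (a := T)
    rw [Nat.cast_add, add_div, div_self hT'.ne']
    refine add_le_add_right ?_ 1
    rw [div_le_div_iff₀ hT' (Real.sqrt_pos.2 hT'), one_mul]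
    calc (Nat.sqrt T : ℝ) * Real.sqrt T ≤ Real.sqrt T * Real.sqrt T := by gcongr
      _ = T := Real.mul_self_sqrt hT'.le

theorem transmissible_of_card_privateBits_le {net : Network N} {src : Source N}
    (hcut : ∀ S, (src.privateBits S).card ≤ net.cutRank S) : Transmissible net src := by
  classical
  -- An arbitrary code serves any `T` without a zero-error code, which can happen only for finitely
  -- many `T`.
  have hne : ∀ T n, Nonempty (Code net src T n) := fun T n => ⟨Code.ofLinear 0 n⟩
  refine ⟨fun T => T + Nat.sqrt T, fun T =>
    if h : ∃ c : Code net src T (T + Nat.sqrt T), c.errorProb = 0 then h.choose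
    else (hne _ _).some, tendsto_add_sqrt_div, ?_⟩
  refine tendsto_const_nhds.congr' ?_
  filter_upwards [(tendsto_polynomial_sqrt_div_two_pow N src.n₀).eventually_lt_const one_pos]
    with T hT
  have h := Code.exists_errorProb_eq_zero hcut hT
  rw [dif_pos h]
  exact h.choose_spec.symm

end FFNet

theorem theorem2 {N : ℕ} (net : FFNet.Network N) (src : FFNet.Source N) :
    FFNet.Transmissible net src ↔
      ∀ S : Finset (Fin N),
        FFNet.condEntropy src.law (src.USet S) (src.USet Sᶜ) ≤ (net.cutRank S : ℝ) := by
  simp only [src.condEntropy_eq, Nat.cast_le]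
  exact ⟨fun h S => h.card_privateBits_le S, FFNet.transmissible_of_card_privateBits_le⟩
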